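/- **Setting.** Let $Q(x,y)=ax^2+hxy+by^2$ be a binary quadratic form with integer coefficients. Put $L=\begin{pmatrix}1&1\\0&1\end{pmatrix}$ and $R=\begin{pmatrix}1&0\\1&1\end{pmatrix}$. For $\xi\in[0,\infty]$ let $\gamma_\xi$ be the path to $\xi$ in the Farey tree: set $A_0(\xi)=I$ and, if $A_n(\xi)=\begin{pmatrix}p&q\\r&s\end{pmatrix}$ (so that $\frac qs\le\xi\le\frac pr$), let $A_{n+1}(\xi)=A_n(\xi)L$ if $\xi>\frac{p+q}{r+s}$ and $A_{n+1}(\xi)=A_n(\xi)R$ if $\xi<\frac{p+q}{r+s}$. If $\xi$ equals the mediant $\frac{p+q}{r+s}$, which happens at most once and only for rational $\xi$, either choice is allowed (all statements hold for both). For $\xi<0$, $\gamma_\xi$ is the reflection of $\gamma_{-\xi}$: $A_n(\xi)$ is obtained from $A_n(-\xi)$ by replacing each factor $L,R$ by $L^{-1},R^{-1}$. With $e_1,e_2$ the columns of $A_n(\xi)$, the $n$-th superbase of $\gamma_\xi$ is $(\pm e_1,\pm e_2,\pm(e_1+e_2))$; let $a_n,b_n,c_n$ be the values of $Q$ on it,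 and for $\xi\in\mathbb RP^1=\mathbb R\cup\{\infty\}$ define $$\Lambda_Q(\xi)=\limsup_{n\to\infty}\frac{\ln\max(|a_n|,|b_n|,|c_n|)}{n},\qquad \Lambda(\xi)=\limsup_{n\to\infty}\frac{\ln\rho(A_n(\xi))}{n},$$ where $\rho$ is the spectral radius. **Theorem.** (1) If $Q$ is (positive or negative) definite, then $\Lambda_Q(\xi)=2\Lambda(\xi)$ for all $\xi\in\mathbb RP^1$. (2) If $Q$ is indefinite and does not represent zero (that is, $Q(x,y)\ne0$ for all $(x,y)\in\mathbb Z^2\setminus\{(0,0)\}$), then the equation $Q(\xi,1)=0$ has exactly two real roots $\alpha_+\neq\alpha_-$, both irrational, and $$\Lambda_Q(\xi)=2\Lambda(\xi)\ \text{ for all }\xi\in\mathbb RP^1\setminus\{\alpha_+,\alpha_-\},\qquad \Lambda_Q(\alpha_\pm)=0\neq2\Lambda(\alpha_\pm).$$ Moreover $\alpha_\pm$ are the two ends of the Conway river of $Q$ (the set of edges of the tree that separate a positive from a negative value of $Q$): for $\xi\in\mathbb RP^1$, all edges of $\gamma_\xi$ from some step on belong to the river, that is, $Q(e_1)Q(e_2)<0$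 for all large $n$, if and only if $\xi\in\{\alpha_+,\alpha_-\}$. -/

import Mathlib

open Filter Topology

noncomputable section

namespace Topograph

/-- The integer binary quadratic form `Q(x, y) = a x² + h x y + b y²`. -/
structure BinForm where
  a : ℤ
  h : ℤ
  b : ℤ

/-- The value `Q(x, y)`, for `x`, `y` in any commutative ring. -/
def BinForm.eval {K : Type*} [CommRing K] (Q : BinForm) (x y : K) : K :=
  (Q.a : K) * x ^ 2 + (Q.h : K) * x * y + (Q.b : K) * y ^ 2

/-- `Q` is (positive or negative) definite. -/
def BinForm.IsDefinite (Q : BinForm) : Prop :=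
  (∀ x y : ℝ, (x, y) ≠ (0, 0) → 0 < Q.eval x y) ∨
    (∀ x y : ℝ, (x, y) ≠ (0, 0) → Q.eval x y < 0)

/-- `Q` is indefinite: it takes both positive and negative values. -/
def BinForm.IsIndefinite (Q : BinForm) : Prop :=
  (∃ x y : ℝ, 0 < Q.eval x y) ∧ (∃ x y : ℝ, Q.eval x y < 0)

/-- `Q` represents zero: it vanishes at a nonzero integer vector. -/
def BinForm.RepresentsZero (Q : BinForm) : Prop :=
  ∃ x y : ℤ, (x, y) ≠ (0, 0) ∧ Q.eval x y = 0

/-- A left or right turn on the planar binary tree. -/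
inductive Turn where
  | left : Turn
  | right : Turn

/-- The matrices `L` and `R` generating the monoid `SL₂(ℕ)`. -/
def Turn.mat : Turn → Matrix (Fin 2) (Fin 2) ℤ
  | .left => !![1, 1; 0, 1]
  | .right => !![1, 0; 1, 1]

/-- The turn made by the Farey path to `ξ ∈ [0, ∞]` after the edge that carries the matrix
`A = (p q; r s)`, that is, the edge between the adjacent fractions `q/s < p/r`. The next vertex
splits the interval at the mediant `(p+q)/(r+s)`; the path turns left if `ξ` lies above the mediant
and right if it lies below. If `ξ` equals the mediant (this happens at most once, and only if `ξ` is
rational) the turn is `tie`; the two values of `tie` give the two infinite paths to `ξ`. -/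
def fareyTurn (tie : Turn) (ξ : OnePoint ℝ) (A : Matrix (Fin 2) (Fin 2) ℤ) : Turn :=
  match ξ with
  | OnePoint.infty => .left
  | OnePoint.some x =>
    if ((A 0 0 + A 0 1 : ℤ) : ℝ) < ((A 1 0 + A 1 1 : ℤ) : ℝ) * x then .left
    else if ((A 1 0 + A 1 1 : ℤ) : ℝ) * x < ((A 0 0 + A 0 1 : ℤ) : ℝ) then .right
    else tie

/-- The product of the first `n` matrices `L`, `R` along the Farey path to `ξ ∈ [0, ∞]`, which
starts at the edge between `0/1` and `1/0`. -/
def fareyMat (tie : Turn) (ξ : OnePoint ℝ) : ℕ → Matrix (Fin 2) (Fin 2) ℤ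
  | 0 => 1
  | n + 1 => fareyMat tie ξ n * (fareyTurn tie ξ (fareyMat tie ξ n)).mat

/-- Conjugation by `diag(1, -1)`. It reflects the fractions `x ↦ -x` and replaces each factor
`L`, `R` of a product by `L⁻¹`, `R⁻¹`. -/
def reflect (A : Matrix (Fin 2) (Fin 2) ℤ) : Matrix (Fin 2) (Fin 2) ℤ :=
  !![A 0 0, -A 0 1; -A 1 0, A 1 1]

theorem reflect_mul (A B : Matrix (Fin 2) (Fin 2) ℤ) :
    reflect (A * B) = reflect A * reflect B := by
  ext i j
  fin_cases i <;> fin_cases j <;> simp [reflect, Matrix.mul_apply, Fin.sum_univ_two] <;> ring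

theorem reflect_mat_mul_mat (t : Turn) : reflect t.mat * t.mat = 1 := by
  cases t <;> decide

/-- The matrix `A_n(ξ)` on the path `γ_ξ` of the full Farey tree, `ξ ∈ ℝP¹ = ℝ ∪ {∞}`. For `ξ < 0`
the path is the reflection of the path to `-ξ`. -/
def pathMat (tie : Turn) (ξ : OnePoint ℝ) (n : ℕ) : Matrix (Fin 2) (Fin 2) ℤ :=
  match ξ with
  | OnePoint.infty => fareyMat tie OnePoint.infty n
  | OnePoint.some x =>
    if 0 ≤ x then fareyMat tie (OnePoint.some x) n
    else reflect (fareyMat tie (OnePoint.some (-x)) n)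

/-- `|Q_n(ξ)| = max(|a_n|, |b_n|, |c_n|)`: the maximal absolute value of `Q` on the `n`-th superbase
`(±e₁, ±e₂, ±(e₁ + e₂))` of `γ_ξ`, where `e₁`, `e₂` are the columns of `A_n(ξ)`. The superbase for
`n = 0` is the vertex `(1, 0), (0, 1), (1, 1)`, where all the paths start. -/
def BinForm.pathMax (Q : BinForm) (tie : Turn) (ξ : OnePoint ℝ) (n : ℕ) : ℤ :=
  let A := pathMat tie ξ n
  max |Q.eval (A 0 0) (A 1 0)|
    (max |Q.eval (A 0 1) (A 1 1)| |Q.eval (A 0 0 + A 0 1) (A 1 0 + A 1 1)|)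

/-- The Lyapunov exponent `Λ_Q(ξ) = limsup (ln |Q_n(ξ)|) / n`, as an extended real number. -/
def BinForm.lyapunov (Q : BinForm) (tie : Turn) (ξ : OnePoint ℝ) : EReal :=
  limsup (fun n : ℕ => ((Real.log (Q.pathMax tie ξ n : ℝ) / (n : ℝ) : ℝ) : EReal)) atTop

/-- The spectral radius of an integer matrix: the largest modulus of a complex eigenvalue. -/
def specRadius (A : Matrix (Fin 2) (Fin 2) ℤ) : ℝ :=
  (spectralRadius ℂ (A.map (Int.cast : ℤ → ℂ))).toReal

/-- The Lyapunov exponent `Λ(ξ) = limsup (ln ρ(A_n(ξ))) / n` of the monoid `SL₂(ℕ)`, as an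
extended real number. -/
def lyapunov (tie : Turn) (ξ : OnePoint ℝ) : EReal :=
  limsup (fun n : ℕ => ((Real.log (specRadius (pathMat tie ξ n)) / (n : ℝ) : ℝ) : EReal)) atTop

/-- The path `γ_ξ` leads to an end of the Conway river of `Q`: from some step on, all its edges
separate a positive from a negative value of `Q`, so that they belong to the river. -/
def BinForm.LeadsToRiverEnd (Q : BinForm) (tie : Turn) (ξ : OnePoint ℝ) : Prop :=
  ∀ᶠ n : ℕ in atTop,
    Q.eval (pathMat tie ξ n 0 0) (pathMat tie ξ n 1 0) *
      Q.eval (pathMat tie ξ n 0 1) (pathMat tie ξ n 1 1) < 0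

end Topograph

end

namespace Topograph

/-! For `x ≥ 0` write `A_n = (p q; r s)`. Then `ps - qr = 1` and `q/s ≤ x ≤ p/r`, so `u = p - xr`
and `v = xs - q` are nonnegative with `us + vr = 1`. Since `rs → ∞`, both fractions tend to `x`.

Off the roots, homogeneity gives `Q(p, r) ~ Q(x, 1) r²` and likewise for `(q, s)`, so the maximum
over the superbase is comparable to `(r + s)²`. The spectral radius is comparable to the trace `p +
s`, hence to `r + s` up to a factor linear in `n`. Such factors disappear in `log / n`, which leaves
the ratio 2 (`BinForm.limsup_superbaseMax`). Both values of `Q` finally have the sign of `Q(x, 1)`,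
so the path leaves the river.

At a root, integrality gives `1 ≤ |Q(p, r)| ≤ K u r`. With `us ≤ 1` this yields `s ≤ Kr`, and by
symmetry `r ≤ Ks`. So `Q` stays bounded (`HasRoots.exists_bounds`), while `rs` gains a factor `1 +
1/K` at every turn and the spectral radius grows exponentially (`HasRoots.limsup_specRadius_pos`).
The fractions straddle a simple root, so `Q` has opposite signs on the two columns.

Negative `x` reduces to `-x` and the form `Q(x, -y)`; at infinity the matrices are explicit. -/

/-! ### Comparing exponential growth rates. -/

theorem limsup_coe_le_of_tendsto_sub {u v : ℕ → ℝ}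
    (h : Tendsto (fun n => u n - v n) atTop (𝓝 0)) :
    limsup (fun n => (u n : EReal)) atTop ≤ limsup (fun n => (v n : EReal)) atTop := by
  have h0 : limsup (fun n => ((u n - v n : ℝ) : EReal)) atTop = 0 := by
    have := (continuous_coe_real_ereal.tendsto 0).comp h
    exact this.limsup_eq
  have h1 : (fun n => (u n : EReal))
      = (fun n => (v n : EReal)) + fun n => ((u n - v n : ℝ) : EReal) := by
    funext n
    rw [Pi.add_apply, ← EReal.coe_add]
    congr 1
    ring
  rw [h1]
  refine (EReal.limsup_add_le (Or.inr ?_) (Or.inr ?_)).trans ?_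
  · rw [h0]; exact EReal.zero_ne_top
  · rw [h0]; exact EReal.zero_ne_bot
  · rw [h0, add_zero]

theorem limsup_coe_eq_of_tendsto_sub {u v : ℕ → ℝ}
    (h : Tendsto (fun n => u n - v n) atTop (𝓝 0)) :
    limsup (fun n => (u n : EReal)) atTop = limsup (fun n => (v n : EReal)) atTop := by
  refine le_antisymm (limsup_coe_le_of_tendsto_sub h) (limsup_coe_le_of_tendsto_sub ?_)
  simpa using h.neg

theorem tendsto_log_succ_div :
    Tendsto (fun n : ℕ => Real.log ((n : ℝ) + 1) / n) atTop (𝓝 0) := by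
  -- Evaluated at `n + 1`, the denominator `1 * (n + 1) + (-1)` is `n`.
  have h := (Real.tendsto_pow_log_div_mul_add_atTop 1 (-1) 1 one_ne_zero).comp
    (tendsto_atTop_add_const_right atTop (1 : ℝ) tendsto_natCast_atTop_atTop)
  refine h.congr fun n => ?_
  simp

/-- If `f` and `g²` agree up to a polynomial factor, the exponential growth rate of `f` is twice
that of `g`. -/
theorem limsup_log_div_eq_two_mul {f g : ℕ → ℝ} {C : ℝ} (hC : 0 < C)
    (hf : ∀ᶠ n in atTop, 0 < f n) (hg : ∀ᶠ n in atTop, 0 < g n)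
    (h₁ : ∀ᶠ n : ℕ in atTop, f n ≤ C * ((n : ℝ) + 1) ^ 2 * g n ^ 2)
    (h₂ : ∀ᶠ n : ℕ in atTop, g n ^ 2 ≤ C * ((n : ℝ) + 1) ^ 2 * f n) :
    limsup (fun n : ℕ => ((Real.log (f n) / (n : ℝ) : ℝ) : EReal)) atTop
      = 2 * limsup (fun n : ℕ => ((Real.log (g n) / (n : ℝ) : ℝ) : EReal)) atTop := by
  rw [← EReal.limsup_const_mul_of_nonneg_of_ne_top (by norm_num) (by decide)]
  have h2 : (fun n : ℕ => (2 : EReal) * ((Real.log (g n) / (n : ℝ) : ℝ) : EReal))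
      = fun n : ℕ => ((2 * (Real.log (g n) / (n : ℝ)) : ℝ) : EReal) := by
    funext n
    rw [EReal.coe_mul]; rfl
  rw [h2]
  apply limsup_coe_eq_of_tendsto_sub
  have hlim : Tendsto (fun n : ℕ => Real.log C / n + 2 * (Real.log ((n : ℝ) + 1) / n))
      atTop (𝓝 0) := by
    simpa using (tendsto_const_div_atTop_nhds_zero_nat (Real.log C)).add
      (tendsto_log_succ_div.const_mul 2)
  refine squeeze_zero_norm' ?_ hlim
  filter_upwards [hf, hg, h₁, h₂, eventually_gt_atTop 0] with n hf hg h₁ h₂ hn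
  have hn' : (0 : ℝ) < n := by exact_mod_cast hn
  have hlog : ∀ a : ℝ, 0 < a → Real.log (C * ((n : ℝ) + 1) ^ 2 * a)
      = Real.log C + 2 * Real.log ((n : ℝ) + 1) + Real.log a := by
    intro a ha
    rw [Real.log_mul (by positivity) ha.ne', Real.log_mul hC.ne' (by positivity), Real.log_pow]
    norm_num
  have e1 := Real.log_le_log hf h₁
  have e2 := Real.log_le_log (by positivity) h₂
  rw [hlog _ (by positivity), Real.log_pow] at e1
  rw [hlog _ hf, Real.log_pow] at e2
  push_cast at e1 e2
  have : Real.log (f n) / n - 2 * (Real.log (g n) / n)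
      = (Real.log (f n) - 2 * Real.log (g n)) / n := by ring
  rw [this, Real.norm_eq_abs, abs_div, abs_of_pos hn',
    show Real.log C / n + 2 * (Real.log ((n : ℝ) + 1) / n)
      = (Real.log C + 2 * Real.log ((n : ℝ) + 1)) / n by ring]
  gcongr
  rw [abs_le]
  constructor <;> linarith

/-! ### Spectral radius and trace. -/

theorem mem_spectrum_iff_of_det_eq_one {A : Matrix (Fin 2) (Fin 2) ℤ} (hdet : A.det = 1) (k : ℂ) :
    k ∈ spectrum ℂ (A.map (Int.cast : ℤ → ℂ)) ↔ k ^ 2 - (A.trace : ℂ) * k + 1 = 0 := by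
  have hd : ((A 0 0 : ℤ) : ℂ) * A 1 1 - A 0 1 * A 1 0 = 1 := by
    rw [Matrix.det_fin_two] at hdet
    exact_mod_cast hdet
  rw [spectrum.mem_iff, Matrix.isUnit_iff_isUnit_det, Matrix.det_fin_two, isUnit_iff_ne_zero,
    not_not]
  simp only [Matrix.sub_apply, Matrix.algebraMap_matrix_apply, Matrix.map_apply,
    Matrix.trace_fin_two]
  simp only [Fin.isValue, Algebra.algebraMap_self, RingHom.id_apply, if_true, zero_ne_one,
    one_ne_zero, if_false]
  push_cast
  constructor <;> intro h
  · linear_combination h - hd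
  · linear_combination h + hd

/-- Every eigenvalue satisfies `|k|² ≤ t|k| + 1`, which bounds it above. As `t ≥ 2`, the root `(t +
√(t² - 4)) / 2` is real and at least `t / 2`. -/
theorem specRadius_bounds {A : Matrix (Fin 2) (Fin 2) ℤ} (hdet : A.det = 1) (htr : 2 ≤ A.trace) :
    (A.trace : ℝ) / 2 ≤ specRadius A ∧ specRadius A ≤ 2 * A.trace := by
  set t : ℝ := (A.trace : ℝ) with ht
  have ht2 : 2 ≤ t := by rw [ht]; exact_mod_cast htr
  have htC : (A.trace : ℂ) = (t : ℂ) := by rw [ht]; simp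
  have hub : spectralRadius ℂ (A.map (Int.cast : ℤ → ℂ)) ≤ ENNReal.ofReal (2 * t) := by
    refine iSup₂_le fun k hk => ?_
    rw [mem_spectrum_iff_of_det_eq_one hdet, htC] at hk
    have hk' : k ^ 2 = t * k - 1 := by linear_combination hk
    have hn : ‖k‖ ^ 2 ≤ t * ‖k‖ + 1 := by
      rw [← norm_pow, hk']
      refine (norm_sub_le _ _).trans ?_
      rw [norm_mul, Complex.norm_real, Real.norm_of_nonneg (by linarith), norm_one]
    have hle : ‖k‖ ≤ 2 * t := by
      by_contra! hlt
      nlinarith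
    rw [ENNReal.le_ofReal_iff_toReal_le (by simp) (by linarith)]
    simpa using hle
  have hne : spectralRadius ℂ (A.map (Int.cast : ℤ → ℂ)) ≠ ⊤ :=
    ne_top_of_le_ne_top ENNReal.ofReal_ne_top hub
  refine ⟨?_, ENNReal.toReal_le_of_le_ofReal (by linarith) hub⟩
  set k : ℝ := (t + √(t ^ 2 - 4)) / 2 with hk
  have hs : √(t ^ 2 - 4) ^ 2 = t ^ 2 - 4 := Real.sq_sqrt (by nlinarith)
  have hmem : (k : ℂ) ∈ spectrum ℂ (A.map (Int.cast : ℤ → ℂ)) := by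
    rw [mem_spectrum_iff_of_det_eq_one hdet, htC]
    have : k ^ 2 - t * k + 1 = 0 := by
      rw [hk]; linear_combination hs / 4
    exact_mod_cast this
  have hkt : t / 2 ≤ k := by
    rw [hk]; linarith [Real.sqrt_nonneg (t ^ 2 - 4)]
  have hle : ((‖(k : ℂ)‖₊ : NNReal) : ENNReal) ≤ spectralRadius ℂ (A.map (Int.cast : ℤ → ℂ)) :=
    le_iSup₂ (f := fun (x : ℂ) (_ : x ∈ spectrum ℂ (A.map (Int.cast : ℤ → ℂ))) =>
      ((‖x‖₊ : NNReal) : ENNReal)) (k : ℂ) hmem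
  have := ENNReal.toReal_mono hne hle
  simp only [ENNReal.coe_toReal, coe_nnnorm, Complex.norm_real] at this
  exact hkt.trans ((le_abs_self k).trans this)

/-! ### Farey matrices of a nonnegative real. -/

/-- The inequalities are weak, so either turn at a tie is covered and `tie` needs no further case
analysis. -/
theorem fareyMat_coe_succ (tie : Turn) (x : ℝ) (n : ℕ) :
    (((fareyMat tie x n 0 0 : ℝ) + fareyMat tie x n 0 1 ≤
        (fareyMat tie x n 1 0 + fareyMat tie x n 1 1) * x) ∧
      fareyMat tie x (n + 1) 0 0 = fareyMat tie x n 0 0 ∧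
      fareyMat tie x (n + 1) 0 1 = fareyMat tie x n 0 0 + fareyMat tie x n 0 1 ∧
      fareyMat tie x (n + 1) 1 0 = fareyMat tie x n 1 0 ∧
      fareyMat tie x (n + 1) 1 1 = fareyMat tie x n 1 0 + fareyMat tie x n 1 1) ∨
    (((fareyMat tie x n 1 0 + fareyMat tie x n 1 1) * x ≤
        (fareyMat tie x n 0 0 : ℝ) + fareyMat tie x n 0 1) ∧
      fareyMat tie x (n + 1) 0 0 = fareyMat tie x n 0 0 + fareyMat tie x n 0 1 ∧
      fareyMat tie x (n + 1) 0 1 = fareyMat tie x n 0 1 ∧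
      fareyMat tie x (n + 1) 1 0 = fareyMat tie x n 1 0 + fareyMat tie x n 1 1 ∧
      fareyMat tie x (n + 1) 1 1 = fareyMat tie x n 1 1) := by
  set A := fareyMat tie x n with hA
  have hsucc : fareyMat tie x (n + 1) = A * (fareyTurn tie x A).mat := rfl
  rw [hsucc]
  rcases ht : fareyTurn tie x A with _ | _
  · left
    refine ⟨?_, ?_⟩
    · by_contra! hlt
      have : fareyTurn tie x A = .right := by
        simp only [fareyTurn]
        push_cast
        rw [if_neg hlt.le.not_gt, if_pos hlt]
      simp [this] at ht
    · simp [Turn.mat, Matrix.mul_apply, Fin.sum_univ_two]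
  · right
    refine ⟨?_, ?_⟩
    · by_contra! hlt
      have : fareyTurn tie x A = .left := by
        simp only [fareyTurn]
        push_cast
        rw [if_pos hlt]
      simp [this] at ht
    · simp [Turn.mat, Matrix.mul_apply, Fin.sum_univ_two]

/-- The entries `p, q, r, s` of the `n`-th matrix satisfy `q/s ≤ x ≤ p/r` and `ps - qr = 1`. -/
theorem fareyMat_invariants (tie : Turn) {x : ℝ} (hx : 0 ≤ x) (n : ℕ) :
    1 ≤ fareyMat tie x n 0 0 ∧ 0 ≤ fareyMat tie x n 0 1 ∧ 0 ≤ fareyMat tie x n 1 0 ∧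
      1 ≤ fareyMat tie x n 1 1 ∧
      fareyMat tie x n 0 0 * fareyMat tie x n 1 1 - fareyMat tie x n 0 1 * fareyMat tie x n 1 0 = 1 ∧
      (fareyMat tie x n 0 1 : ℝ) ≤ fareyMat tie x n 1 1 * x ∧
      (fareyMat tie x n 1 0 : ℝ) * x ≤ fareyMat tie x n 0 0 := by
  induction n with
  | zero => simp [fareyMat, hx]
  | succ n ih =>
    obtain ⟨hp, hq, hr, hs, hd, h1, h2⟩ := ih
    rcases fareyMat_coe_succ tie x n with ⟨h, e1, e2, e3, e4⟩ | ⟨h, e1, e2, e3, e4⟩ <;>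
      rw [e1, e2, e3, e4]
    · refine ⟨hp, by omega, hr, by omega, by linear_combination hd, ?_, h2⟩
      push_cast; exact h
    · refine ⟨by omega, hq, by omega, hs, by linear_combination hd, h1, ?_⟩
      push_cast; exact h

/-- The entry `r` stays 0 only as long as all turns are left, and then the matrix is `L ^ n`. -/
theorem fareyMat_bottom_left_dichotomy (tie : Turn) {x : ℝ} (hx : 0 ≤ x) (n : ℕ) :
    1 ≤ fareyMat tie x n 1 0 ∨ (fareyMat tie x n 0 0 = 1 ∧ fareyMat tie x n 0 1 = n ∧
      fareyMat tie x n 1 1 = 1) := by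
  induction n with
  | zero => right; simp [fareyMat]
  | succ n ih =>
    obtain ⟨hp, hq, hr, hs, hd, -, -⟩ := fareyMat_invariants tie hx n
    rcases fareyMat_coe_succ tie x n with ⟨h, e1, e2, e3, e4⟩ | ⟨h, e1, e2, e3, e4⟩ <;>
      rw [e1, e2, e3, e4] <;> push_cast
    · rcases ih with ih | ⟨i1, i2, i3⟩
      · left; exact ih
      · have : fareyMat tie x n 1 0 = 0 ∨ 1 ≤ fareyMat tie x n 1 0 := by omega
        omega
    · left; omega

theorem eventually_one_le_bottom_left (tie : Turn) {x : ℝ} (hx : 0 ≤ x) :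
    ∀ᶠ n in atTop, 1 ≤ fareyMat tie x n 1 0 := by
  filter_upwards [eventually_gt_atTop ⌈x⌉₊] with n hn
  rcases fareyMat_bottom_left_dichotomy tie hx n with h | ⟨-, h2, h3⟩
  · exact h
  · obtain ⟨-, -, -, -, -, h1, -⟩ := fareyMat_invariants tie hx n
    rw [h2, h3] at h1
    have := Nat.lt_of_ceil_lt hn
    push_cast at h1
    linarith

theorem tendsto_bottom_mul (tie : Turn) {x : ℝ} (hx : 0 ≤ x) :
    Tendsto (fun n => (fareyMat tie x n 1 0 : ℝ) * fareyMat tie x n 1 1) atTop atTop := by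
  obtain ⟨N, hN⟩ := eventually_atTop.1 (eventually_one_le_bottom_left tie hx)
  -- Once `r, s ≥ 1`, each turn raises `r + s` by at least 1, and `rs ≥ r + s - 1`.
  have key : ∀ k : ℕ, (k : ℤ) ≤ fareyMat tie x (N + k) 1 0 + fareyMat tie x (N + k) 1 1 - 1 := by
    intro k
    induction k with
    | zero =>
      obtain ⟨-, -, hr, hs, -⟩ := fareyMat_invariants tie hx (N + 0)
      push_cast; omega
    | succ k ih =>
      have hr := hN (N + k) (by omega)
      obtain ⟨-, -, -, hs, -⟩ := fareyMat_invariants tie hx (N + k)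
      rw [← add_assoc]
      rcases fareyMat_coe_succ tie x (N + k) with ⟨h, e1, e2, e3, e4⟩ | ⟨h, e1, e2, e3, e4⟩ <;>
        rw [e3, e4] <;> push_cast <;> omega
  refine tendsto_atTop_mono' _ ?_
    (tendsto_atTop_add_const_right atTop (-(N : ℝ)) tendsto_natCast_atTop_atTop)
  filter_upwards [eventually_ge_atTop N] with n hn
  obtain ⟨k, rfl⟩ := Nat.exists_eq_add_of_le hn
  have hr := hN (N + k) (by omega)
  obtain ⟨-, -, -, hs, -⟩ := fareyMat_invariants tie hx (N + k)
  have h1 : (k : ℤ) ≤ fareyMat tie x (N + k) 1 0 * fareyMat tie x (N + k) 1 1 := by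
    nlinarith [key k]
  have h2 : (k : ℝ) ≤ fareyMat tie x (N + k) 1 0 * fareyMat tie x (N + k) 1 1 := by
    exact_mod_cast h1
  push_cast
  linarith

/-- The two nonnegative left-hand sides add up to the determinant 1. -/
theorem approx_mul_le_one (tie : Turn) {x : ℝ} (hx : 0 ≤ x) (n : ℕ) :
    ((fareyMat tie x n 0 0 : ℝ) - x * fareyMat tie x n 1 0) * fareyMat tie x n 1 1 ≤ 1 ∧
      (x * fareyMat tie x n 1 1 - (fareyMat tie x n 0 1 : ℝ)) * fareyMat tie x n 1 0 ≤ 1 := by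
  obtain ⟨hp, hq, hr, hs, hd, h1, h2⟩ := fareyMat_invariants tie hx n
  have hr' : (0 : ℝ) ≤ fareyMat tie x n 1 0 := by exact_mod_cast hr
  have hs' : (1 : ℝ) ≤ fareyMat tie x n 1 1 := by exact_mod_cast hs
  have hd' : (fareyMat tie x n 0 0 : ℝ) * fareyMat tie x n 1 1
    - fareyMat tie x n 0 1 * fareyMat tie x n 1 0 = 1 := by exact_mod_cast hd
  constructor
  · nlinarith [mul_nonneg hr' (sub_nonneg.2 h1)]
  · nlinarith [mul_nonneg (by linarith : (0 : ℝ) ≤ fareyMat tie x n 1 1) (sub_nonneg.2 h2)]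

/-- Dividing `approx_mul_le_one` by `rs` bounds both errors by `1 / (rs)`. -/
theorem tendsto_fractions (tie : Turn) {x : ℝ} (hx : 0 ≤ x) :
    Tendsto (fun n => (fareyMat tie x n 0 0 : ℝ) / fareyMat tie x n 1 0) atTop (𝓝 x) ∧
      Tendsto (fun n => (fareyMat tie x n 0 1 : ℝ) / fareyMat tie x n 1 1) atTop (𝓝 x) := by
  have hinv := (tendsto_bottom_mul tie hx).inv_tendsto_atTop
  constructor <;> rw [tendsto_iff_norm_sub_tendsto_zero] <;>
    refine squeeze_zero' (Eventually.of_forall fun _ => norm_nonneg _) ?_ hinv <;>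
    filter_upwards [eventually_one_le_bottom_left tie hx] with n hr <;>
    obtain ⟨hp, hq, -, hs, hd, h1, h2⟩ := fareyMat_invariants tie hx n <;>
    obtain ⟨a1, a2⟩ := approx_mul_le_one tie hx n <;>
    have hr' : (0 : ℝ) < fareyMat tie x n 1 0 := by exact_mod_cast hr
  all_goals have hs' : (0 : ℝ) < fareyMat tie x n 1 1 := by exact_mod_cast hs
  · have : (fareyMat tie x n 0 0 : ℝ) / fareyMat tie x n 1 0 - x
        = (fareyMat tie x n 0 0 - x * fareyMat tie x n 1 0) / fareyMat tie x n 1 0 := by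
      field_simp
    rw [this, Real.norm_of_nonneg (div_nonneg (by linarith) hr'.le), Pi.inv_apply,
      div_le_iff₀ hr', mul_inv, mul_right_comm, inv_mul_cancel₀ hr'.ne', one_mul, ← one_div,
      le_div_iff₀ hs']
    exact a1
  · have : (fareyMat tie x n 0 1 : ℝ) / fareyMat tie x n 1 1 - x
        = -((x * fareyMat tie x n 1 1 - fareyMat tie x n 0 1) / fareyMat tie x n 1 1) := by
      field_simp; ring
    rw [this, norm_neg, Real.norm_of_nonneg (div_nonneg (by linarith) hs'.le), Pi.inv_apply,
      div_le_iff₀ hs', mul_inv, mul_assoc, inv_mul_cancel₀ hs'.ne', mul_one, ← one_div,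
      le_div_iff₀ hr']
    exact a2

/-! ### Values of the form along a path, away from its roots. -/

theorem BinForm.eval_intCast (Q : BinForm) (X Y : ℤ) :
    ((Q.eval X Y : ℤ) : ℝ) = Q.eval (X : ℝ) (Y : ℝ) := by
  simp [BinForm.eval]

/-- The largest absolute value of `Q` on the superbase `(e₁, e₂, e₁ + ε e₂)`, `ε = ±1`, where
`e₁, e₂` are the columns of `A`. -/
def BinForm.superbaseMax (Q : BinForm) (ε : ℤ) (A : Matrix (Fin 2) (Fin 2) ℤ) : ℤ :=
  max |Q.eval (A 0 0) (A 1 0)|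
    (max |Q.eval (A 0 1) (A 1 1)| |Q.eval (A 0 0 + ε * A 0 1) (A 1 0 + ε * A 1 1)|)

theorem BinForm.abs_eval_le (Q : BinForm) {X Y T : ℤ} (hX : |X| ≤ T) (hY : |Y| ≤ T) :
    |Q.eval X Y| ≤ (|Q.a| + |Q.h| + |Q.b|) * T ^ 2 := by
  have h1 : |X| * |X| ≤ T * T := mul_le_mul hX hX (abs_nonneg _) ((abs_nonneg _).trans hX)
  have h2 : |X| * |Y| ≤ T * T := mul_le_mul hX hY (abs_nonneg _) ((abs_nonneg _).trans hX)
  have h3 : |Y| * |Y| ≤ T * T := mul_le_mul hY hY (abs_nonneg _) ((abs_nonneg _).trans hX)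
  have e : |Q.eval X Y| ≤ |Q.a| * (|X| * |X|) + |Q.h| * (|X| * |Y|) + |Q.b| * (|Y| * |Y|) := by
    simp only [← abs_mul]
    refine le_trans (le_of_eq ?_) ((abs_add_le _ _).trans (add_le_add_left (abs_add_le _ _) _))
    simp only [BinForm.eval, Int.cast_id]
    ring_nf
  nlinarith [mul_le_mul_of_nonneg_left h1 (abs_nonneg Q.a),
    mul_le_mul_of_nonneg_left h2 (abs_nonneg Q.h), mul_le_mul_of_nonneg_left h3 (abs_nonneg Q.b)]

theorem BinForm.superbaseMax_le (Q : BinForm) {ε : ℤ} (hε : |ε| = 1)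
    {A : Matrix (Fin 2) (Fin 2) ℤ} {T : ℤ} (h : ∀ i, |A i 0| + |A i 1| ≤ T) :
    Q.superbaseMax ε A ≤ (|Q.a| + |Q.h| + |Q.b|) * T ^ 2 := by
  have h0 : ∀ i, |A i 0| ≤ T := fun i => by linarith [h i, abs_nonneg (A i 1)]
  have h1 : ∀ i, |A i 1| ≤ T := fun i => by linarith [h i, abs_nonneg (A i 0)]
  have h2 : ∀ i, |A i 0 + ε * A i 1| ≤ T := fun i => by
    refine (abs_add_le _ _).trans ?_
    rw [abs_mul, hε, one_mul]
    exact h i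
  exact max_le (Q.abs_eval_le (h0 0) (h0 1))
    (max_le (Q.abs_eval_le (h1 0) (h1 1)) (Q.abs_eval_le (h2 0) (h2 1)))

theorem BinForm.tendsto_eval_div_sq (Q : BinForm) {x : ℝ} {X Y : ℕ → ℤ}
    (h : Tendsto (fun n => (X n : ℝ) / Y n) atTop (𝓝 x)) (hY : ∀ᶠ n in atTop, 1 ≤ Y n) :
    Tendsto (fun n => ((Q.eval (X n) (Y n) : ℤ) : ℝ) / (Y n : ℝ) ^ 2) atTop (𝓝 (Q.eval x 1)) := by
  have hc : Continuous fun t : ℝ => Q.eval t 1 := by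
    unfold BinForm.eval; fun_prop
  refine ((hc.tendsto x).comp h).congr' ?_
  filter_upwards [hY] with n hn
  have : (Y n : ℝ) ≠ 0 := by
    have : (1 : ℝ) ≤ Y n := by exact_mod_cast hn
    positivity
  rw [Q.eval_intCast]
  simp only [Function.comp, BinForm.eval]
  field_simp

theorem BinForm.tendsto_eval_fareyMat (Q : BinForm) (tie : Turn) {x : ℝ} (hx : 0 ≤ x) :
    Tendsto (fun n => ((Q.eval (fareyMat tie x n 0 0) (fareyMat tie x n 1 0) : ℤ) : ℝ) /
      (fareyMat tie x n 1 0 : ℝ) ^ 2) atTop (𝓝 (Q.eval x 1)) ∧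
    Tendsto (fun n => ((Q.eval (fareyMat tie x n 0 1) (fareyMat tie x n 1 1) : ℤ) : ℝ) /
      (fareyMat tie x n 1 1 : ℝ) ^ 2) atTop (𝓝 (Q.eval x 1)) :=
  ⟨Q.tendsto_eval_div_sq (tendsto_fractions tie hx).1 (eventually_one_le_bottom_left tie hx),
    Q.tendsto_eval_div_sq (tendsto_fractions tie hx).2
      (Eventually.of_forall fun n => (fareyMat_invariants tie hx n).2.2.2.1)⟩

theorem BinForm.eventually_mul_pos (Q : BinForm) (tie : Turn) {x : ℝ} (hx : 0 ≤ x)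
    (hQ : Q.eval x 1 ≠ 0) :
    ∀ᶠ n in atTop, 0 < Q.eval (fareyMat tie x n 0 0) (fareyMat tie x n 1 0) *
      Q.eval (fareyMat tie x n 0 1) (fareyMat tie x n 1 1) := by
  obtain ⟨h1, h2⟩ := Q.tendsto_eval_fareyMat tie hx
  have hpos : (0 : ℝ) < Q.eval x 1 * Q.eval x 1 := mul_self_pos.2 hQ
  filter_upwards [(h1.mul h2).eventually (lt_mem_nhds hpos),
    eventually_one_le_bottom_left tie hx] with n hn hr
  obtain ⟨-, -, -, hs, -⟩ := fareyMat_invariants tie hx n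
  have hr' : (0 : ℝ) < fareyMat tie x n 1 0 := by exact_mod_cast hr
  have hs' : (0 : ℝ) < fareyMat tie x n 1 1 := by exact_mod_cast hs
  rw [div_mul_div_comm, div_pos_iff_of_pos_right (by positivity)] at hn
  exact_mod_cast hn

/-- Off the roots of `Q`, the values of `Q` along the path grow like the squares of the
denominators. -/
theorem BinForm.eventually_le_superbaseMax (Q : BinForm) (tie : Turn) (ε : ℤ) {x : ℝ} (hx : 0 ≤ x)
    (hQ : Q.eval x 1 ≠ 0) :
    ∀ᶠ n in atTop, |Q.eval x 1| / 8 * ((fareyMat tie x n 1 0 : ℝ) + fareyMat tie x n 1 1) ^ 2 ≤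
      Q.superbaseMax ε (fareyMat tie x n) := by
  obtain ⟨h1, h2⟩ := Q.tendsto_eval_fareyMat tie hx
  have hpos : 0 < |Q.eval x 1| := abs_pos.2 hQ
  filter_upwards [h1.abs.eventually (lt_mem_nhds (half_lt_self hpos)),
    h2.abs.eventually (lt_mem_nhds (half_lt_self hpos)),
    eventually_one_le_bottom_left tie hx] with n hn1 hn2 hr
  obtain ⟨-, -, -, hs, -⟩ := fareyMat_invariants tie hx n
  have hr' : (0 : ℝ) < fareyMat tie x n 1 0 := by exact_mod_cast hr
  have hs' : (0 : ℝ) < fareyMat tie x n 1 1 := by exact_mod_cast hs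
  rw [abs_div, abs_of_pos (by positivity : (0 : ℝ) < (fareyMat tie x n 1 0 : ℝ) ^ 2),
    lt_div_iff₀ (by positivity)] at hn1
  rw [abs_div, abs_of_pos (by positivity : (0 : ℝ) < (fareyMat tie x n 1 1 : ℝ) ^ 2),
    lt_div_iff₀ (by positivity)] at hn2
  have m1 : |((Q.eval (fareyMat tie x n 0 0) (fareyMat tie x n 1 0) : ℤ) : ℝ)|
      ≤ Q.superbaseMax ε (fareyMat tie x n) := by
    rw [← Int.cast_abs]; exact_mod_cast le_max_left _ _
  have m2 : |((Q.eval (fareyMat tie x n 0 1) (fareyMat tie x n 1 1) : ℤ) : ℝ)|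
      ≤ Q.superbaseMax ε (fareyMat tie x n) := by
    rw [← Int.cast_abs]; exact_mod_cast (le_max_left _ _).trans (le_max_right _ _)
  -- The maximum is at least the mean of the two values, hence at least `|Q(x, 1)| (r² + s²) / 4`;
  -- then `(r + s)² ≤ 2 (r² + s²)` gives the constant 1/8.
  nlinarith [mul_nonneg hpos.le
    (sq_nonneg ((fareyMat tie x n 1 0 : ℝ) - fareyMat tie x n 1 1))]

theorem fareyMat_det_trace (tie : Turn) {x : ℝ} (hx : 0 ≤ x) (n : ℕ) :
    (fareyMat tie x n).det = 1 ∧ 2 ≤ (fareyMat tie x n).trace := by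
  obtain ⟨hp, -, -, hs, hd, -⟩ := fareyMat_invariants tie hx n
  rw [Matrix.det_fin_two, Matrix.trace_fin_two]
  exact ⟨hd, by omega⟩

theorem top_row_le (tie : Turn) {x : ℝ} (hx : 0 ≤ x) (n : ℕ) :
    (fareyMat tie x n 0 0 : ℝ) ≤ x * fareyMat tie x n 1 0 + 1 ∧
      (fareyMat tie x n 0 1 : ℝ) ≤ x * fareyMat tie x n 1 1 := by
  obtain ⟨hp, hq, hr, hs, hd, h1, h2⟩ := fareyMat_invariants tie hx n
  obtain ⟨a1, -⟩ := approx_mul_le_one tie hx n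
  have hs' : (1 : ℝ) ≤ fareyMat tie x n 1 1 := by exact_mod_cast hs
  exact ⟨by nlinarith, by linarith⟩

/-- At `x = 0` the invariants force `q = 0` and `s = 1`, so a turn adds at most 1 to `r`. -/
theorem fareyMat_zero (tie : Turn) (n : ℕ) : fareyMat tie (0 : ℝ) n 1 0 ≤ n := by
  induction n with
  | zero => simp [fareyMat]
  | succ n ih =>
    obtain ⟨hp, hq, hr, hs, hd, h1, h2⟩ := fareyMat_invariants tie le_rfl n
    rw [mul_zero] at h1
    have hq0 : fareyMat tie (0 : ℝ) n 0 1 = 0 := le_antisymm (by exact_mod_cast h1) hq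
    rw [hq0] at hd
    have hs1 : fareyMat tie (0 : ℝ) n 1 1 = 1 := by nlinarith
    rcases fareyMat_coe_succ tie 0 n with ⟨h, e1, e2, e3, e4⟩ | ⟨h, e1, e2, e3, e4⟩ <;>
      rw [e3] <;> push_cast <;> omega

/-- The trace controls the denominators, up to a linear factor that is needed only at `x = 0`. -/
theorem exists_bottom_row_le_trace (tie : Turn) {x : ℝ} (hx : 0 ≤ x) :
    ∃ C : ℝ, 0 < C ∧ ∀ n : ℕ, (fareyMat tie x n 1 0 : ℝ) + fareyMat tie x n 1 1 ≤
      C * ((n : ℝ) + 1) * (fareyMat tie x n).trace := by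
  rcases hx.eq_or_lt with rfl | hx0
  · refine ⟨1, one_pos, fun n => ?_⟩
    obtain ⟨hp, hq, hr, hs, -⟩ := fareyMat_invariants tie hx n
    have h : (fareyMat tie (0 : ℝ) n 1 0 : ℝ) ≤ n := by exact_mod_cast fareyMat_zero tie n
    have hp' : (1 : ℝ) ≤ fareyMat tie (0 : ℝ) n 0 0 := by exact_mod_cast hp
    have hs' : (1 : ℝ) ≤ fareyMat tie (0 : ℝ) n 1 1 := by exact_mod_cast hs
    rw [Matrix.trace_fin_two]
    push_cast
    nlinarith [(Nat.cast_nonneg n : (0 : ℝ) ≤ n)]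
  -- For `x > 0`, `r ≤ p / x` bounds the denominators by the trace without the factor `n + 1`.
  · refine ⟨1 / x + 1, by positivity, fun n => ?_⟩
    obtain ⟨hp, hq, hr, hs, hd, h1, h2⟩ := fareyMat_invariants tie hx n
    have hp' : (1 : ℝ) ≤ fareyMat tie x n 0 0 := by exact_mod_cast hp
    have hs' : (1 : ℝ) ≤ fareyMat tie x n 1 1 := by exact_mod_cast hs
    rw [← le_div_iff₀ hx0] at h2
    rw [Matrix.trace_fin_two]
    push_cast
    have hx' : 0 < 1 / x := by positivity
    have e : (fareyMat tie x n 1 0 : ℝ) + fareyMat tie x n 1 1 ≤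
        (1 / x + 1) * ((fareyMat tie x n 0 0 : ℝ) + fareyMat tie x n 1 1) := by
      rw [div_eq_mul_one_div] at h2
      nlinarith
    refine e.trans ?_
    rw [mul_right_comm]
    refine le_mul_of_one_le_right (by positivity) ?_
    linarith [(Nat.cast_nonneg n : (0 : ℝ) ≤ n)]

theorem BinForm.limsup_superbaseMax (Q : BinForm) (tie : Turn) {ε : ℤ} (hε : |ε| = 1) {x : ℝ}
    (hx : 0 ≤ x) (hQ : Q.eval x 1 ≠ 0) :
    limsup (fun n : ℕ => ((Real.log (Q.superbaseMax ε (fareyMat tie x n) : ℝ) / (n : ℝ) : ℝ) :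
      EReal)) atTop =
    2 * limsup (fun n : ℕ => ((Real.log (specRadius (fareyMat tie x n)) / (n : ℝ) : ℝ) :
      EReal)) atTop := by
  obtain ⟨C, hC, hCn⟩ := exists_bottom_row_le_trace tie hx
  set c := |Q.eval x 1| / 8 with hc
  have hcpos : 0 < c := by have := abs_pos.2 hQ; positivity
  set M : ℝ := |(Q.a : ℝ)| + |(Q.h : ℝ)| + |(Q.b : ℝ)| with hM
  have hM0 : 0 ≤ M := by positivity
  have hlow := Q.eventually_le_superbaseMax tie ε hx hQ
  have hT : ∀ n, (0 : ℝ) ≤ fareyMat tie x n 1 0 ∧ (1 : ℝ) ≤ fareyMat tie x n 1 1 ∧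
      (0 : ℝ) ≤ fareyMat tie x n 0 1 ∧ (1 : ℝ) ≤ fareyMat tie x n 0 0 := fun n => by
    obtain ⟨hp, hq, hr, hs, -⟩ := fareyMat_invariants tie hx n
    exact ⟨by exact_mod_cast hr, by exact_mod_cast hs, by exact_mod_cast hq, by exact_mod_cast hp⟩
  have hrho : ∀ n, ((fareyMat tie x n).trace : ℝ) / 2 ≤ specRadius (fareyMat tie x n) ∧
      specRadius (fareyMat tie x n) ≤ 2 * (fareyMat tie x n).trace := fun n =>
    specRadius_bounds (fareyMat_det_trace tie hx n).1 (fareyMat_det_trace tie hx n).2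
  have htr : ∀ n, (2 : ℝ) ≤ (fareyMat tie x n).trace := fun n => by
    exact_mod_cast (fareyMat_det_trace tie hx n).2
  have hup : ∀ n, (Q.superbaseMax ε (fareyMat tie x n) : ℝ) ≤
      M * ((x + 2) * ((fareyMat tie x n 1 0 : ℝ) + fareyMat tie x n 1 1)) ^ 2 := fun n => by
    obtain ⟨hr, hs, hq, hp⟩ := hT n
    obtain ⟨t1, t2⟩ := top_row_le tie hx n
    obtain ⟨hp0, hq0, hr0, hs0, -⟩ := fareyMat_invariants tie hx n
    have h := Q.superbaseMax_le (A := fareyMat tie x n) (T := fareyMat tie x n 0 0 +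
      fareyMat tie x n 0 1 + fareyMat tie x n 1 0 + fareyMat tie x n 1 1) hε (by
        intro i
        fin_cases i <;> simp only [Fin.zero_eta, Fin.mk_one]
        · rw [abs_of_nonneg (by omega), abs_of_nonneg hq0]; omega
        · rw [abs_of_nonneg hr0, abs_of_nonneg (by omega)]; omega)
    have h' : (Q.superbaseMax ε (fareyMat tie x n) : ℝ) ≤ M * ((fareyMat tie x n 0 0 : ℝ) +
        fareyMat tie x n 0 1 + fareyMat tie x n 1 0 + fareyMat tie x n 1 1) ^ 2 := by
      rw [hM]; exact_mod_cast h
    refine h'.trans ?_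
    gcongr
    nlinarith
  -- The first summand serves the upper bound for `Q`, the second the upper bound for the spectral
  -- radius.
  refine limsup_log_div_eq_two_mul (C := 4 * M * (x + 2) ^ 2 * C ^ 2 + 16 * (x + 2) ^ 2 / c)
    (by positivity) ?_ ?_ ?_ ?_
  · filter_upwards [hlow] with n hn
    obtain ⟨hr, hs, -⟩ := hT n
    exact lt_of_lt_of_le (by positivity) hn
  · exact Eventually.of_forall fun n => by linarith [hrho n, htr n]
  · refine Eventually.of_forall fun n => ?_
    obtain ⟨hr, hs, -⟩ := hT n
    have hn0 : (0 : ℝ) ≤ n := Nat.cast_nonneg n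
    have hρ := (hrho n).1
    have h2 := htr n
    calc (Q.superbaseMax ε (fareyMat tie x n) : ℝ)
        ≤ M * ((x + 2) * ((fareyMat tie x n 1 0 : ℝ) + fareyMat tie x n 1 1)) ^ 2 := hup n
      _ ≤ M * ((x + 2) * (C * ((n : ℝ) + 1) * (2 * specRadius (fareyMat tie x n)))) ^ 2 := by
          gcongr
          exact (hCn n).trans (by gcongr; linarith)
      _ = 4 * M * (x + 2) ^ 2 * C ^ 2 * ((n : ℝ) + 1) ^ 2 * specRadius (fareyMat tie x n) ^ 2 := by
          ring
      _ ≤ _ := by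
          gcongr
          exact le_add_of_nonneg_right (by positivity)
  · filter_upwards [hlow] with n hn
    obtain ⟨hr, hs, hq, hp⟩ := hT n
    obtain ⟨t1, t2⟩ := top_row_le tie hx n
    have hn0 : (0 : ℝ) ≤ n := Nat.cast_nonneg n
    have hρ := hrho n
    have h2 := htr n
    have htrT : ((fareyMat tie x n).trace : ℝ) ≤
        (x + 2) * ((fareyMat tie x n 1 0 : ℝ) + fareyMat tie x n 1 1) := by
      rw [Matrix.trace_fin_two]; push_cast; nlinarith
    have hf0 : (0 : ℝ) ≤ Q.superbaseMax ε (fareyMat tie x n) := le_trans (by positivity) hn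
    calc specRadius (fareyMat tie x n) ^ 2
        ≤ (2 * ((x + 2) * ((fareyMat tie x n 1 0 : ℝ) + fareyMat tie x n 1 1))) ^ 2 := by
          refine pow_le_pow_left₀ (by linarith) (by linarith) 2
      _ = 4 * (x + 2) ^ 2 / c * (c * ((fareyMat tie x n 1 0 : ℝ) + fareyMat tie x n 1 1) ^ 2) := by
          field_simp; ring
      _ ≤ 4 * (x + 2) ^ 2 / c * Q.superbaseMax ε (fareyMat tie x n) := by gcongr
      _ ≤ (4 * M * (x + 2) ^ 2 * C ^ 2 + 16 * (x + 2) ^ 2 / c) * ((n : ℝ) + 1) ^ 2 *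
          Q.superbaseMax ε (fareyMat tie x n) := by
          gcongr
          have e1 : 4 * (x + 2) ^ 2 / c ≤ 4 * M * (x + 2) ^ 2 * C ^ 2 + 16 * (x + 2) ^ 2 / c := by
            refine le_add_of_nonneg_of_le (by positivity) ?_
            gcongr; norm_num
          refine e1.trans (le_mul_of_one_le_right (by positivity) ?_)
          exact one_le_pow₀ (by linarith)

/-! ### The path to infinity. -/

theorem fareyMat_infty (tie : Turn) (n : ℕ) :
    fareyMat tie OnePoint.infty n = !![1, (n : ℤ); 0, 1] := by
  induction n with
  | zero => ext i j; fin_cases i <;> fin_cases j <;> simp [fareyMat]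
  | succ n ih =>
    rw [fareyMat, ih]
    ext i j
    fin_cases i <;> fin_cases j <;>
      simp [fareyTurn, Turn.mat, Matrix.mul_apply, Fin.sum_univ_two, add_comm]

/-- The spectral radius of `L ^ n` stays between 1 and 4, and the maximum of `Q` between 1 and a
quadratic polynomial in `n`. The lower bound is `|Q(1, 0)| = |a| ≥ 1`. -/
theorem BinForm.limsup_superbaseMax_infty (Q : BinForm) (tie : Turn) (ha : Q.a ≠ 0) :
    limsup (fun n : ℕ => ((Real.log (Q.superbaseMax 1 (fareyMat tie OnePoint.infty n) : ℝ) /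
      (n : ℝ) : ℝ) : EReal)) atTop =
    2 * limsup (fun n : ℕ => ((Real.log (specRadius (fareyMat tie OnePoint.infty n)) /
      (n : ℝ) : ℝ) : EReal)) atTop := by
  simp only [fareyMat_infty]
  have hrho : ∀ n : ℕ, 1 ≤ specRadius !![1, (n : ℤ); 0, 1] ∧
      specRadius !![1, (n : ℤ); 0, 1] ≤ 4 := fun n => by
    have h := specRadius_bounds (A := !![1, (n : ℤ); 0, 1]) (by simp [Matrix.det_fin_two])
      (by simp [Matrix.trace_fin_two])
    simp only [Matrix.trace_fin_two_of] at h
    norm_num at h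
    exact h
  set M : ℝ := |(Q.a : ℝ)| + |(Q.h : ℝ)| + |(Q.b : ℝ)| with hM
  have hM0 : 0 ≤ M := by positivity
  have hlow : ∀ n : ℕ, (1 : ℝ) ≤ Q.superbaseMax 1 !![1, (n : ℤ); 0, 1] := fun n => by
    have h : (1 : ℤ) ≤ Q.superbaseMax 1 !![1, (n : ℤ); 0, 1] := by
      refine (Int.one_le_abs ha).trans (le_trans (le_of_eq ?_) (le_max_left _ _))
      simp [BinForm.eval]
    exact_mod_cast h
  have hup : ∀ n : ℕ, (Q.superbaseMax 1 !![1, (n : ℤ); 0, 1] : ℝ) ≤ M * ((n : ℝ) + 1) ^ 2 :=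
      fun n => by
    have h := Q.superbaseMax_le (ε := 1) (A := !![1, (n : ℤ); 0, 1]) (T := n + 1) (by simp) (by
      intro i; fin_cases i
      · simp [add_comm]
      · simp)
    rw [hM]; exact_mod_cast h
  refine limsup_log_div_eq_two_mul (C := M + 16) (by positivity)
    (Eventually.of_forall fun n => by linarith [hlow n])
    (Eventually.of_forall fun n => by linarith [hrho n]) ?_ ?_ <;>
    refine Eventually.of_forall fun n => ?_
  · have h1 : (1 : ℝ) ≤ specRadius !![1, (n : ℤ); 0, 1] ^ 2 := one_le_pow₀ (hrho n).1
    refine ((hup n).trans ?_).trans (le_mul_of_one_le_right (by positivity) h1)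
    gcongr
    linarith
  · have h1 : specRadius !![1, (n : ℤ); 0, 1] ^ 2 ≤ 4 ^ 2 :=
      pow_le_pow_left₀ (by linarith [hrho n]) (hrho n).2 2
    have h2 : (1 : ℝ) ≤ ((n : ℝ) + 1) ^ 2 := one_le_pow₀ (by simp)
    have h3 := mul_le_mul h2 (hlow n) zero_le_one (by positivity)
    nlinarith

/-! ### Paths to the roots of the form. -/

/-- The form `Q` is `a (X - x Y) (X - x' Y)` with distinct real `x, x'`, and has no nonzero integer
zero. -/
structure BinForm.HasRoots (Q : BinForm) (x x' : ℝ) : Prop where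
  ne : x ≠ x'
  factor : ∀ X Y : ℝ, Q.eval X Y = Q.a * ((X - x * Y) * (X - x' * Y))
  eval_ne_zero : ∀ X Y : ℤ, (X, Y) ≠ (0, 0) → Q.eval X Y ≠ 0

theorem BinForm.HasRoots.one_le_abs_mul {Q : BinForm} {x x' : ℝ} (h : Q.HasRoots x x') {X Y : ℤ}
    (hXY : (X, Y) ≠ (0, 0)) : 1 ≤ |(Q.a : ℝ)| * (|X - x * Y| * |X - x' * Y|) := by
  rw [← abs_mul, ← abs_mul, ← h.factor, ← Q.eval_intCast, ← Int.cast_abs]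
  exact_mod_cast Int.one_le_abs (h.eval_ne_zero X Y hXY)

/-- On the path to a root, the two denominators are comparable and `Q` stays bounded. -/
theorem BinForm.HasRoots.exists_bounds {Q : BinForm} {x x' : ℝ} (h : Q.HasRoots x x') (tie : Turn)
    {ε : ℤ} (hε : |ε| = 1) (hx : 0 ≤ x) :
    ∃ K : ℝ, 0 < K ∧ ∀ᶠ n in atTop,
      (fareyMat tie x n 1 0 : ℝ) ≤ K * fareyMat tie x n 1 1 ∧
      (fareyMat tie x n 1 1 : ℝ) ≤ K * fareyMat tie x n 1 0 ∧
      (Q.superbaseMax ε (fareyMat tie x n) : ℝ) ≤ K * (2 * K + 2) := by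
  -- Since `p ≤ (x + 1) r` and `q ≤ xs`, the first summand bounds `|a| |p - x' r| / r` and `|a| |q -
  -- x' s| / s`; the 1 makes `K` positive.
  refine ⟨|(Q.a : ℝ)| * (x + 1 + |x'|) + 1, by positivity, ?_⟩
  set K := |(Q.a : ℝ)| * (x + 1 + |x'|) + 1 with hK
  have hK0 : 0 < K := by positivity
  have hKa : |(Q.a : ℝ)| * (x + 1 + |x'|) ≤ K := by linarith
  filter_upwards [eventually_one_le_bottom_left tie hx] with n hr
  obtain ⟨hp, hq, -, hs, hd, h1, h2⟩ := fareyMat_invariants tie hx n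
  obtain ⟨a1, a2⟩ := approx_mul_le_one tie hx n
  obtain ⟨t1, t2⟩ := top_row_le tie hx n
  have l1 := h.one_le_abs_mul (X := fareyMat tie x n 0 0) (Y := fareyMat tie x n 1 0)
    (by simp; omega)
  have l2 := h.one_le_abs_mul (X := fareyMat tie x n 0 1) (Y := fareyMat tie x n 1 1)
    (by simp; omega)
  have hr' : (1 : ℝ) ≤ fareyMat tie x n 1 0 := by exact_mod_cast hr
  have hs' : (1 : ℝ) ≤ fareyMat tie x n 1 1 := by exact_mod_cast hs
  have hp' : (1 : ℝ) ≤ fareyMat tie x n 0 0 := by exact_mod_cast hp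
  have hq' : (0 : ℝ) ≤ fareyMat tie x n 0 1 := by exact_mod_cast hq
  have hε' : |(ε : ℝ)| = 1 := by rw [← Int.cast_abs, hε, Int.cast_one]
  have habs : ∀ X Y : ℤ, |((Q.eval X Y : ℤ) : ℝ)|
      = |(Q.a : ℝ)| * (|X - x * Y| * |X - x' * Y|) := fun X Y => by
    rw [Q.eval_intCast, h.factor, abs_mul, abs_mul]
  have hbm : (Q.superbaseMax ε (fareyMat tie x n) : ℝ) =
      max |((Q.eval (fareyMat tie x n 0 0) (fareyMat tie x n 1 0) : ℤ) : ℝ)|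
        (max |((Q.eval (fareyMat tie x n 0 1) (fareyMat tie x n 1 1) : ℤ) : ℝ)|
          |((Q.eval (fareyMat tie x n 0 0 + ε * fareyMat tie x n 0 1)
            (fareyMat tie x n 1 0 + ε * fareyMat tie x n 1 1) : ℤ) : ℝ)|) := by
    simp [BinForm.superbaseMax]
  rw [hbm]
  simp only [habs]
  push_cast
  generalize (fareyMat tie x n 0 0 : ℝ) = p at *
  generalize (fareyMat tie x n 0 1 : ℝ) = q at *
  generalize (fareyMat tie x n 1 0 : ℝ) = r at *
  generalize (fareyMat tie x n 1 1 : ℝ) = s at *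
  have hu0 : 0 ≤ p - x * r := by linarith
  have hv0 : 0 ≤ x * s - q := by linarith
  have eu : |p - x * r| = p - x * r := abs_of_nonneg hu0
  have ev : |q - x * s| = x * s - q := by rw [abs_sub_comm, abs_of_nonneg hv0]
  have bp : |p - x' * r| ≤ (x + 1 + |x'|) * r := by
    refine (abs_sub _ _).trans ?_
    rw [abs_mul, abs_of_pos (by linarith : 0 < p), abs_of_pos (by linarith : 0 < r)]
    nlinarith
  have bq : |q - x' * s| ≤ (x + 1 + |x'|) * s := by
    refine (abs_sub _ _).trans ?_
    rw [abs_mul, abs_of_nonneg hq', abs_of_pos (by linarith : 0 < s)]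
    nlinarith
  rw [eu] at l1 ⊢
  rw [ev] at l2 ⊢
  set u := p - x * r with hu
  set v := x * s - q with hv
  have hA0 : 0 ≤ |(Q.a : ℝ)| := abs_nonneg _
  have gen : ∀ z w y : ℝ, 0 ≤ z → 0 ≤ y → w ≤ (x + 1 + |x'|) * y →
      |(Q.a : ℝ)| * (z * w) ≤ K * (z * y) := fun z w y hz hy hw => by
    calc |(Q.a : ℝ)| * (z * w) ≤ |(Q.a : ℝ)| * (z * ((x + 1 + |x'|) * y)) := by gcongr
      _ = |(Q.a : ℝ)| * (x + 1 + |x'|) * (z * y) := by ring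
      _ ≤ K * (z * y) := by gcongr
  have g1 := gen u _ r hu0 (by linarith) bp
  have g2 := gen v _ s hv0 (by linarith) bq
  -- Integrality `1 ≤ |Q(p, r)| ≤ K u r` is played against `us ≤ 1`.
  have m1 : s ≤ K * r := by
    calc s = 1 * s := (one_mul s).symm
      _ ≤ K * (u * r) * s := by gcongr; linarith
      _ = K * r * (u * s) := by ring
      _ ≤ K * r * 1 := by gcongr
      _ = K * r := mul_one _
  have m2 : r ≤ K * s := by
    calc r = 1 * r := (one_mul r).symm
      _ ≤ K * (v * s) * r := by gcongr; linarith
      _ = K * s * (v * r) := by ring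
      _ ≤ K * s * 1 := by gcongr
      _ = K * s := mul_one _
  have ur : u * r ≤ K := by
    calc u * r ≤ u * (K * s) := by gcongr
      _ = K * (u * s) := by ring
      _ ≤ K * 1 := by gcongr
      _ = K := mul_one _
  have vs : v * s ≤ K := by
    calc v * s ≤ v * (K * r) := by gcongr
      _ = K * (v * r) := by ring
      _ ≤ K * 1 := by gcongr
      _ = K := mul_one _
  refine ⟨m2, m1, max_le (g1.trans ?_) (max_le (g2.trans ?_) ?_)⟩
  · gcongr; linarith
  · gcongr; linarith
  -- The third value is at most `K (u + v)(r + s)`, where `ur, vs ≤ K` and `us, vr ≤ 1`.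
  · have c1 : |p + ε * q - x * (r + ε * s)| ≤ u + v := by
      have : p + ε * q - x * (r + ε * s) = u - ε * v := by rw [hu, hv]; ring
      rw [this]
      refine (abs_sub _ _).trans ?_
      rw [abs_mul, hε', one_mul, abs_of_nonneg hu0, abs_of_nonneg hv0]
    have c2 : |p + ε * q - x' * (r + ε * s)| ≤ (x + 1 + |x'|) * (r + s) := by
      have : p + ε * q - x' * (r + ε * s) = (p - x' * r) + ε * (q - x' * s) := by ring
      rw [this]
      refine (abs_add_le _ _).trans ?_
      rw [abs_mul, hε', one_mul]
      linarith
    calc _ ≤ |(Q.a : ℝ)| * ((u + v) * |p + ε * q - x' * (r + ε * s)|) := by gcongr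
      _ ≤ K * ((u + v) * (r + s)) := gen _ _ _ (by linarith) (by linarith) c2
      _ = K * (u * r + v * s + (u * s + v * r)) := by ring
      _ ≤ K * (2 * K + 2) := mul_le_mul_of_nonneg_left (by linarith) hK0.le

theorem BinForm.HasRoots.limsup_superbaseMax {Q : BinForm} {x x' : ℝ} (h : Q.HasRoots x x')
    (tie : Turn) {ε : ℤ} (hε : |ε| = 1) (hx : 0 ≤ x) :
    limsup (fun n : ℕ => ((Real.log (Q.superbaseMax ε (fareyMat tie x n) : ℝ) / (n : ℝ) : ℝ) :
      EReal)) atTop = 0 := by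
  obtain ⟨K, hK, hev⟩ := h.exists_bounds tie hε hx
  have hlim : Tendsto (fun n : ℕ => Real.log (Q.superbaseMax ε (fareyMat tie x n) : ℝ) / (n : ℝ))
      atTop (𝓝 0) := by
    refine squeeze_zero' ?_ ?_ (tendsto_const_div_atTop_nhds_zero_nat
      (Real.log (K * (2 * K + 2)))) <;>
      filter_upwards [hev] with n hn <;>
      obtain ⟨hp, -⟩ := fareyMat_invariants tie hx n
    all_goals
      have h1 : (1 : ℝ) ≤ Q.superbaseMax ε (fareyMat tie x n) := by
        have : (1 : ℤ) ≤ Q.superbaseMax ε (fareyMat tie x n) :=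
          (Int.one_le_abs (h.eval_ne_zero _ _ (by simp; omega))).trans (le_max_left _ _)
        exact_mod_cast this
    · exact div_nonneg (Real.log_nonneg h1) (Nat.cast_nonneg n)
    · gcongr
      exact hn.2.2
  exact ((continuous_coe_real_ereal.tendsto 0).comp hlim).limsup_eq

/-- The spectral radius grows exponentially on the path to a quadratic irrationality. -/
theorem BinForm.HasRoots.limsup_specRadius_pos {Q : BinForm} {x x' : ℝ} (h : Q.HasRoots x x')
    (tie : Turn) (hx : 0 ≤ x) :
    0 < limsup (fun n : ℕ => ((Real.log (specRadius (fareyMat tie x n)) / (n : ℝ) : ℝ) :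
      EReal)) atTop := by
  obtain ⟨K, hK, hev⟩ := h.exists_bounds tie (ε := 1) (by simp) hx
  obtain ⟨N, hN⟩ := eventually_atTop.1 (hev.and (eventually_one_le_bottom_left tie hx))
  -- A turn adds `r²` or `s²` to `rs`; comparability of `r` and `s` makes either at least `rs / K`.
  set μ : ℝ := 1 + 1 / K with hμ
  have hμ1 : 1 < μ := by rw [hμ]; linarith [show 0 < 1 / K by positivity]
  have hgrow : ∀ k : ℕ, μ ^ k ≤ (fareyMat tie x (N + k) 1 0 : ℝ) * fareyMat tie x (N + k) 1 1 := by
    intro k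
    have hpos : ∀ j, (1 : ℝ) ≤ fareyMat tie x (N + j) 1 0 ∧
        (1 : ℝ) ≤ fareyMat tie x (N + j) 1 1 := fun j => by
      obtain ⟨-, -, -, hs, -⟩ := fareyMat_invariants tie hx (N + j)
      exact ⟨by exact_mod_cast (hN (N + j) (by omega)).2, by exact_mod_cast hs⟩
    induction k with
    | zero => nlinarith [hpos 0, pow_zero μ]
    | succ k ih =>
      obtain ⟨hr, hs⟩ := hpos k
      obtain ⟨⟨b1, b2, -⟩, -⟩ := hN (N + k) (by omega)
      have b1' : (fareyMat tie x (N + k) 1 0 : ℝ) * (1 / K) ≤ fareyMat tie x (N + k) 1 1 := by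
        rw [mul_one_div, div_le_iff₀ hK]; linarith
      have b2' : (fareyMat tie x (N + k) 1 1 : ℝ) * (1 / K) ≤ fareyMat tie x (N + k) 1 0 := by
        rw [mul_one_div, div_le_iff₀ hK]; linarith
      have e : μ ^ (k + 1) ≤ (fareyMat tie x (N + k) 1 0 : ℝ) * fareyMat tie x (N + k) 1 1 * μ := by
        rw [pow_succ]; gcongr
      refine e.trans ?_
      rw [← add_assoc]
      rcases fareyMat_coe_succ tie x (N + k) with ⟨-, e1, e2, e3, e4⟩ | ⟨-, e1, e2, e3, e4⟩ <;>
        rw [e3, e4, hμ] <;> push_cast <;> nlinarith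
  have hlog : ∀ k : ℕ, ((k : ℝ) * Real.log μ - Real.log (4 * K)) / 2 ≤
      Real.log (specRadius (fareyMat tie x (N + k))) := by
    intro k
    obtain ⟨hp, -, -, hs, -⟩ := fareyMat_invariants tie hx (N + k)
    obtain ⟨⟨b1, -⟩, -⟩ := hN (N + k) (by omega)
    have hp' : (1 : ℝ) ≤ fareyMat tie x (N + k) 0 0 := by exact_mod_cast hp
    have hs' : (1 : ℝ) ≤ fareyMat tie x (N + k) 1 1 := by exact_mod_cast hs
    have hρ := (specRadius_bounds (fareyMat_det_trace tie hx (N + k)).1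
      (fareyMat_det_trace tie hx (N + k)).2).1
    rw [Matrix.trace_fin_two] at hρ
    push_cast at hρ
    have hρs : (fareyMat tie x (N + k) 1 1 : ℝ) / 2 ≤ specRadius (fareyMat tie x (N + k)) := by
      linarith
    -- Here `rs ≤ K s²`, and `s` is at most the trace, hence at most twice the spectral radius.
    have hsq : μ ^ k ≤ 4 * K * specRadius (fareyMat tie x (N + k)) ^ 2 := by
      calc μ ^ k ≤ (fareyMat tie x (N + k) 1 0 : ℝ) * fareyMat tie x (N + k) 1 1 := hgrow k
        _ ≤ K * fareyMat tie x (N + k) 1 1 * fareyMat tie x (N + k) 1 1 := by gcongr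
        _ = 4 * K * (fareyMat tie x (N + k) 1 1 / 2) ^ 2 := by ring
        _ ≤ _ := by gcongr
    have hρ0 : 0 < specRadius (fareyMat tie x (N + k)) := by linarith
    have := Real.log_le_log (by positivity) hsq
    rw [Real.log_pow, Real.log_mul (by positivity) (by positivity), Real.log_pow] at this
    push_cast at this
    linarith
  have hκ : 0 < Real.log μ / 2 := by have := Real.log_pos hμ1; positivity
  have hlim : Tendsto (fun n : ℕ => Real.log μ / 2 -
      ((N : ℝ) * Real.log μ + Real.log (4 * K)) / 2 / n) atTop (𝓝 (Real.log μ / 2)) := by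
    simpa using (tendsto_const_nhds (x := Real.log μ / 2)).sub
      (tendsto_const_div_atTop_nhds_zero_nat (((N : ℝ) * Real.log μ + Real.log (4 * K)) / 2))
  have hlimE := ((continuous_coe_real_ereal.tendsto _).comp hlim).limsup_eq
  refine lt_of_lt_of_le (EReal.coe_pos.2 hκ) ?_
  rw [← hlimE]
  refine limsup_le_limsup ?_
  filter_upwards [eventually_ge_atTop N, eventually_gt_atTop 0] with n hn hn0
  obtain ⟨k, rfl⟩ := Nat.exists_eq_add_of_le hn
  have hpos : (0 : ℝ) < ((N + k : ℕ) : ℝ) := by exact_mod_cast hn0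
  simp only [Function.comp, EReal.coe_le_coe_iff]
  rw [le_div_iff₀ hpos, sub_mul, div_mul_cancel₀ _ hpos.ne']
  refine le_trans (le_of_eq ?_) (hlog k)
  push_cast
  ring

/-- The factors at `x'` finally agree in sign because both fractions approach `x ≠ x'`. The factors
at `x` have opposite signs, strictly since `Q` does not vanish on the columns. -/
theorem BinForm.HasRoots.eventually_mul_neg {Q : BinForm} {x x' : ℝ} (h : Q.HasRoots x x')
    (tie : Turn) (hx : 0 ≤ x) :
    ∀ᶠ n in atTop, Q.eval (fareyMat tie x n 0 0) (fareyMat tie x n 1 0) *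
      Q.eval (fareyMat tie x n 0 1) (fareyMat tie x n 1 1) < 0 := by
  obtain ⟨f1, f2⟩ := tendsto_fractions tie hx
  have hlim := (f1.sub_const x').mul (f2.sub_const x')
  filter_upwards [hlim.eventually (lt_mem_nhds (mul_self_pos.2 (sub_ne_zero.2 h.ne))),
    eventually_one_le_bottom_left tie hx] with n hn hr
  obtain ⟨hp, hq, -, hs, hd, h1, h2⟩ := fareyMat_invariants tie hx n
  have hr' : (0 : ℝ) < fareyMat tie x n 1 0 := by exact_mod_cast hr
  have hs' : (0 : ℝ) < fareyMat tie x n 1 1 := by exact_mod_cast hs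
  have n1 := h.eval_ne_zero (fareyMat tie x n 0 0) (fareyMat tie x n 1 0) (by simp; omega)
  have n2 := h.eval_ne_zero (fareyMat tie x n 0 1) (fareyMat tie x n 1 1) (by simp; omega)
  rw [← Int.cast_ne_zero (α := ℝ), Q.eval_intCast, h.factor] at n1 n2
  rw [← Int.cast_lt_zero (R := ℝ), Int.cast_mul, Q.eval_intCast, Q.eval_intCast, h.factor,
    h.factor]
  generalize (fareyMat tie x n 0 0 : ℝ) = p at *
  generalize (fareyMat tie x n 0 1 : ℝ) = q at *
  generalize (fareyMat tie x n 1 0 : ℝ) = r at *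
  generalize (fareyMat tie x n 1 1 : ℝ) = s at *
  have ha : (Q.a : ℝ) ≠ 0 := left_ne_zero_of_mul n1
  have hu : 0 < p - x * r :=
    lt_of_le_of_ne (by linarith) (left_ne_zero_of_mul (right_ne_zero_of_mul n1)).symm
  have hv : q - x * s < 0 :=
    lt_of_le_of_ne (by linarith) (left_ne_zero_of_mul (right_ne_zero_of_mul n2))
  have hw : 0 < (p - x' * r) * (q - x' * s) := by
    have : (p - x' * r) * (q - x' * s) = (p / r - x') * (q / s - x') * (r * s) := by
      field_simp
    rw [this]; positivity
  have e : Q.a * ((p - x * r) * (p - x' * r)) * (Q.a * ((q - x * s) * (q - x' * s)))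
      = ((Q.a : ℝ) * Q.a) * ((p - x * r) * ((p - x' * r) * (q - x' * s))) * (q - x * s) := by
    ring
  rw [e]
  exact mul_neg_of_pos_of_neg (mul_pos (mul_self_pos.2 ha) (mul_pos hu hw)) hv

/-! ### Reflection, and existence of the roots. -/

theorem specRadius_reflect {A : Matrix (Fin 2) (Fin 2) ℤ} (hdet : A.det = 1) :
    specRadius (reflect A) = specRadius A := by
  have hdet' : (reflect A).det = 1 := by
    rw [Matrix.det_fin_two] at hdet ⊢
    simpa [reflect] using hdet
  have htr : (reflect A).trace = A.trace := by simp [reflect, Matrix.trace_fin_two]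
  have hspec : spectrum ℂ ((reflect A).map (Int.cast : ℤ → ℂ))
      = spectrum ℂ (A.map (Int.cast : ℤ → ℂ)) := by
    ext k
    rw [mem_spectrum_iff_of_det_eq_one hdet', mem_spectrum_iff_of_det_eq_one hdet, htr]
  unfold specRadius spectralRadius
  rw [hspec]

/-- The form `Q(x, -y)`. -/
def BinForm.conj (Q : BinForm) : BinForm := ⟨Q.a, -Q.h, Q.b⟩

theorem BinForm.conj_eval {K : Type*} [CommRing K] (Q : BinForm) (X Y : K) :
    Q.conj.eval X Y = Q.eval X (-Y) := by
  simp [BinForm.eval, BinForm.conj]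

theorem BinForm.eval_neg_neg {K : Type*} [CommRing K] (Q : BinForm) (X Y : K) :
    Q.eval (-X) (-Y) = Q.eval X Y := by
  simp only [BinForm.eval]; ring

theorem BinForm.conj_eval_neg {K : Type*} [CommRing K] (Q : BinForm) (X Y : K) :
    Q.conj.eval (-X) Y = Q.eval X Y := by
  rw [Q.conj_eval, Q.eval_neg_neg]

theorem BinForm.HasRoots.conj {Q : BinForm} {x x' : ℝ} (h : Q.HasRoots x x') :
    Q.conj.HasRoots (-x) (-x') where
  ne := fun e => h.ne (neg_injective e)
  factor X Y := by
    rw [Q.conj_eval, h.factor]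
    simp only [BinForm.conj]
    ring
  eval_ne_zero X Y hXY := by
    rw [Q.conj_eval]
    refine h.eval_ne_zero _ _ fun e => hXY ?_
    simpa using e

theorem BinForm.HasRoots.symm {Q : BinForm} {x x' : ℝ} (h : Q.HasRoots x x') :
    Q.HasRoots x' x where
  ne := h.ne.symm
  factor X Y := by rw [h.factor]; ring
  eval_ne_zero := h.eval_ne_zero

theorem BinForm.HasRoots.eval_eq_zero_iff {Q : BinForm} {x x' : ℝ} (h : Q.HasRoots x x') (t : ℝ) :
    Q.eval t 1 = 0 ↔ t = x ∨ t = x' := by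
  have ha : (Q.a : ℝ) ≠ 0 := by
    have := h.eval_ne_zero 1 0 (by simp)
    simpa [BinForm.eval] using this
  rw [h.factor, mul_one, mul_one, mul_eq_zero_iff_left ha, mul_eq_zero, sub_eq_zero, sub_eq_zero]

theorem BinForm.HasRoots.irrational {Q : BinForm} {x x' : ℝ} (h : Q.HasRoots x x') :
    Irrational x := by
  rintro ⟨t, rfl⟩
  refine h.eval_ne_zero t.num t.den (by simp) ?_
  have ht : (t : ℝ) * t.den = t.num := by exact_mod_cast t.mul_den_eq_num
  rw [← Int.cast_eq_zero (α := ℝ), Q.eval_intCast, h.factor]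
  push_cast
  rw [ht, sub_self, zero_mul, mul_zero]

/-- An indefinite form that does not represent zero has two distinct real roots. -/
theorem BinForm.exists_hasRoots {Q : BinForm} (hQ : Q.IsIndefinite) (h0 : ¬ Q.RepresentsZero) :
    ∃ x x' : ℝ, Q.HasRoots x x' := by
  have hne : ∀ X Y : ℤ, (X, Y) ≠ (0, 0) → Q.eval X Y ≠ 0 :=
    fun X Y hXY he => h0 ⟨X, Y, hXY, he⟩
  have ha : (Q.a : ℝ) ≠ 0 := by
    have := hne 1 0 (by simp)
    simpa [BinForm.eval] using this
  set D : ℝ := (Q.h : ℝ) ^ 2 - 4 * Q.a * Q.b with hD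
  have hsq : ∀ X Y : ℝ, 4 * Q.a * Q.eval X Y = (2 * Q.a * X + Q.h * Y) ^ 2 - D * Y ^ 2 := by
    intro X Y
    simp only [BinForm.eval, hD]
    ring
  -- With `D ≤ 0`, completing the square makes `4aQ ≥ 0` everywhere, so `Q` could not change sign.
  have hDpos : 0 < D := by
    by_contra! hD0
    have hnn : ∀ X Y : ℝ, 0 ≤ 4 * Q.a * Q.eval X Y := fun X Y => by
      rw [hsq]
      nlinarith [sq_nonneg (2 * Q.a * X + Q.h * Y), mul_nonneg (neg_nonneg.2 hD0) (sq_nonneg Y)]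
    obtain ⟨⟨x, y, hp⟩, u, v, hn⟩ := hQ
    rcases ha.lt_or_gt with ha | ha
    · nlinarith [hnn x y, mul_neg_of_neg_of_pos ha hp]
    · nlinarith [hnn u v, mul_neg_of_pos_of_neg ha hn]
  have hs : √D ^ 2 = D := Real.sq_sqrt hDpos.le
  have hs0 : 0 < √D := Real.sqrt_pos.2 hDpos
  refine ⟨(-Q.h + √D) / (2 * Q.a), (-Q.h - √D) / (2 * Q.a), ?_, ?_, hne⟩
  · intro e
    rw [div_left_inj' (by simpa using ha)] at e
    linarith
  · intro X Y
    have h4 : (4 * Q.a : ℝ) ≠ 0 := by simpa using ha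
    apply mul_left_cancel₀ h4
    rw [hsq]
    field_simp
    linear_combination (4 * Y ^ 2) * hs

/-! ### Transfer to paths on the whole projective line. -/

theorem pathMat_of_nonneg (tie : Turn) {x : ℝ} (hx : 0 ≤ x) (n : ℕ) :
    pathMat tie x n = fareyMat tie x n :=
  if_pos hx

theorem pathMat_of_neg (tie : Turn) {x : ℝ} (hx : x < 0) (n : ℕ) :
    pathMat tie x n = reflect (fareyMat tie ((-x : ℝ) : OnePoint ℝ) n) :=
  if_neg hx.not_ge

theorem BinForm.pathMax_of_nonneg (Q : BinForm) (tie : Turn) {x : ℝ} (hx : 0 ≤ x) (n : ℕ) :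
    Q.pathMax tie x n = Q.superbaseMax 1 (fareyMat tie x n) := by
  simp only [BinForm.pathMax, BinForm.superbaseMax, pathMat_of_nonneg tie hx, one_mul]

theorem BinForm.pathMax_infty (Q : BinForm) (tie : Turn) (n : ℕ) :
    Q.pathMax tie OnePoint.infty n = Q.superbaseMax 1 (fareyMat tie OnePoint.infty n) := by
  simp only [BinForm.pathMax, BinForm.superbaseMax, one_mul]
  rfl

theorem BinForm.eval_reflect_zero (Q : BinForm) (A : Matrix (Fin 2) (Fin 2) ℤ) :
    Q.eval (reflect A 0 0) (reflect A 1 0) = Q.conj.eval (A 0 0) (A 1 0) := by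
  simp [Q.conj_eval, reflect]

theorem BinForm.eval_reflect_one (Q : BinForm) (A : Matrix (Fin 2) (Fin 2) ℤ) :
    Q.eval (reflect A 0 1) (reflect A 1 1) = Q.conj.eval (A 0 1) (A 1 1) := by
  rw [Q.conj_eval, ← Q.eval_neg_neg]
  simp [reflect]

/-- The columns of the reflected matrix are `(p, -r)` and `(-q, s)`. Their sum is the mirror image
of the difference `(p - q, r - s)`, which is why `ε = -1` occurs. -/
theorem BinForm.pathMax_of_neg (Q : BinForm) (tie : Turn) {x : ℝ} (hx : x < 0) (n : ℕ) :
    Q.pathMax tie x n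
      = Q.conj.superbaseMax (-1) (fareyMat tie ((-x : ℝ) : OnePoint ℝ) n) := by
  simp only [BinForm.pathMax, BinForm.superbaseMax, pathMat_of_neg tie hx, Q.eval_reflect_zero,
    Q.eval_reflect_one]
  congr 3
  simp only [Q.conj_eval, reflect, Matrix.of_apply, Matrix.cons_val', Matrix.cons_val_zero,
    Matrix.cons_val_one, Matrix.cons_val_fin_one]
  congr 1 <;> ring

/-- The hypotheses say that `Q` does not vanish in the direction `ξ`: `hξ` for finite `ξ`, `ha` for
infinity. -/
theorem BinForm.lyapunov_eq_two_mul (Q : BinForm) (tie : Turn) (ha : Q.a ≠ 0) (ξ : OnePoint ℝ)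
    (hξ : ∀ x : ℝ, ξ = x → Q.eval x 1 ≠ 0) :
    Q.lyapunov tie ξ = 2 * Topograph.lyapunov tie ξ := by
  unfold BinForm.lyapunov Topograph.lyapunov
  induction ξ using OnePoint.rec with
  | infty =>
    simp only [Q.pathMax_infty]
    exact Q.limsup_superbaseMax_infty tie ha
  | coe x =>
    have hx := hξ x rfl
    rcases le_or_gt 0 x with h | h
    · simp only [Q.pathMax_of_nonneg tie h, pathMat_of_nonneg tie h]
      exact Q.limsup_superbaseMax tie (by simp) h hx
    · have h' : 0 ≤ -x := by linarith
      simp only [Q.pathMax_of_neg tie h, pathMat_of_neg tie h,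
        specRadius_reflect (fareyMat_det_trace tie h' _).1]
      exact Q.conj.limsup_superbaseMax tie (by simp) h' (by rwa [Q.conj_eval_neg])

theorem BinForm.HasRoots.lyapunov {Q : BinForm} {x x' : ℝ} (h : Q.HasRoots x x') (tie : Turn) :
    Q.lyapunov tie x = 0 ∧ 2 * Topograph.lyapunov tie x ≠ 0 := by
  suffices H : Q.lyapunov tie x = 0 ∧ 0 < Topograph.lyapunov tie x from
    ⟨H.1, mul_ne_zero (by norm_num) H.2.ne'⟩
  unfold BinForm.lyapunov Topograph.lyapunov
  rcases le_or_gt 0 x with hx | hx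
  · simp only [Q.pathMax_of_nonneg tie hx, pathMat_of_nonneg tie hx]
    exact ⟨h.limsup_superbaseMax tie (by simp) hx, h.limsup_specRadius_pos tie hx⟩
  · have hx' : 0 ≤ -x := by linarith
    simp only [Q.pathMax_of_neg tie hx, pathMat_of_neg tie hx,
      specRadius_reflect (fareyMat_det_trace tie hx' _).1]
    exact ⟨h.conj.limsup_superbaseMax tie (by simp) hx', h.conj.limsup_specRadius_pos tie hx'⟩

theorem BinForm.HasRoots.leadsToRiverEnd {Q : BinForm} {x x' : ℝ} (h : Q.HasRoots x x')
    (tie : Turn) : Q.LeadsToRiverEnd tie x := by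
  unfold BinForm.LeadsToRiverEnd
  rcases le_or_gt 0 x with hx | hx
  · simp only [pathMat_of_nonneg tie hx]
    exact h.eventually_mul_neg tie hx
  · simp only [pathMat_of_neg tie hx, Q.eval_reflect_zero, Q.eval_reflect_one]
    exact h.conj.eventually_mul_neg tie (by linarith)

theorem BinForm.not_leadsToRiverEnd (Q : BinForm) (tie : Turn) (ha : Q.a ≠ 0) (ξ : OnePoint ℝ)
    (hξ : ∀ x : ℝ, ξ = x → Q.eval x 1 ≠ 0) : ¬ Q.LeadsToRiverEnd tie ξ := by
  have key : ∀ u : ℕ → ℤ, (∀ᶠ n in atTop, u n < 0) → ¬ ∀ᶠ n in atTop, 0 < u n :=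
    fun u h1 h2 => by
      obtain ⟨n, a, b⟩ := (h1.and h2).exists
      exact lt_asymm a b
  intro H
  refine key _ H ?_
  clear H
  induction ξ using OnePoint.rec with
  | infty =>
    have hp : ∀ n, pathMat tie OnePoint.infty n = !![1, (n : ℤ); 0, 1] := fareyMat_infty tie
    -- The columns are `(1, 0)` and `(n, 1)`, with values `a` and `a n² + h n + b`; beyond this
    -- threshold the leading term decides the sign.
    filter_upwards [eventually_gt_atTop (|Q.h| + |Q.b|).toNat] with n hn
    have hn' : |Q.h| + |Q.b| < n := by omega
    simp only [hp, BinForm.eval, Matrix.of_apply, Matrix.cons_val', Matrix.cons_val_zero,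
      Matrix.cons_val_one, Matrix.cons_val_fin_one]
    have hn1 : (1 : ℤ) ≤ n := by linarith [abs_nonneg Q.h, abs_nonneg Q.b]
    have e : |Q.h * n + Q.b| < |Q.a * n ^ 2| := by
      calc |Q.h * n + Q.b| ≤ |Q.h| * n + |Q.b| := by
            refine (abs_add_le _ _).trans ?_
            rw [abs_mul, abs_of_nonneg (by omega : (0 : ℤ) ≤ n)]
        _ ≤ (|Q.h| + |Q.b|) * n := by nlinarith [abs_nonneg Q.b]
        _ < n * n := by gcongr
        _ ≤ |Q.a| * (n * n) := le_mul_of_one_le_left (by positivity) (Int.one_le_abs ha)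
        _ = |Q.a * n ^ 2| := by rw [abs_mul, abs_of_nonneg (sq_nonneg (n : ℤ)), sq]
    simp only [Int.cast_id]
    rcases ha.lt_or_gt with ha | ha
    · rw [abs_of_nonpos (by nlinarith [sq_nonneg (n : ℤ)] : Q.a * (n : ℤ) ^ 2 ≤ 0), abs_lt] at e
      exact mul_pos_of_neg_of_neg (by linarith) (by linarith)
    · rw [abs_of_nonneg (by positivity : 0 ≤ Q.a * (n : ℤ) ^ 2), abs_lt] at e
      exact mul_pos (by linarith) (by linarith)
  | coe x =>
    have hx := hξ x rfl
    rcases le_or_gt 0 x with h | h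
    · simp only [pathMat_of_nonneg tie h]
      exact Q.eventually_mul_pos tie h hx
    · simp only [pathMat_of_neg tie h, Q.eval_reflect_zero, Q.eval_reflect_one]
      exact Q.conj.eventually_mul_pos tie (by linarith) (by rwa [Q.conj_eval_neg])

theorem BinForm.IsDefinite.eval_ne_zero {Q : BinForm} (h : Q.IsDefinite) {x y : ℝ}
    (hxy : (x, y) ≠ (0, 0)) : Q.eval x y ≠ 0 :=
  h.elim (fun h => (h x y hxy).ne') fun h => (h x y hxy).ne

end Topograph

theorem mainTheorem1 (tie : Topograph.Turn) (Q : Topograph.BinForm) :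
    (Q.IsDefinite →
      ∀ ξ : OnePoint ℝ, Q.lyapunov tie ξ = 2 * Topograph.lyapunov tie ξ) ∧
    (Q.IsIndefinite → ¬ Q.RepresentsZero →
      ∃ αp αm : ℝ, αp ≠ αm ∧ Irrational αp ∧ Irrational αm ∧
        (∀ x : ℝ, Q.eval x 1 = 0 ↔ x = αp ∨ x = αm) ∧
        (∀ ξ : OnePoint ℝ, ξ ≠ (αp : OnePoint ℝ) → ξ ≠ (αm : OnePoint ℝ) →
          Q.lyapunov tie ξ = 2 * Topograph.lyapunov tie ξ) ∧
        (Q.lyapunov tie (αp : OnePoint ℝ) = 0 ∧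
          2 * Topograph.lyapunov tie (αp : OnePoint ℝ) ≠ 0) ∧
        (Q.lyapunov tie (αm : OnePoint ℝ) = 0 ∧
          2 * Topograph.lyapunov tie (αm : OnePoint ℝ) ≠ 0) ∧
        (∀ ξ : OnePoint ℝ, Q.LeadsToRiverEnd tie ξ ↔
          ξ = (αp : OnePoint ℝ) ∨ ξ = (αm : OnePoint ℝ))) := by
  constructor
  · intro hQ ξ
    have ha : Q.a ≠ 0 := by
      have := hQ.eval_ne_zero (x := 1) (y := 0) (by simp)
      simpa [Topograph.BinForm.eval] using this
    exact Q.lyapunov_eq_two_mul tie ha ξ fun x _ => hQ.eval_ne_zero (by simp)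
  · intro hQ h0
    obtain ⟨αp, αm, h⟩ := Topograph.BinForm.exists_hasRoots hQ h0
    have ha : Q.a ≠ 0 := by
      have := h.eval_ne_zero 1 0 (by simp)
      simpa [Topograph.BinForm.eval] using this
    have hoff : ∀ ξ : OnePoint ℝ, ξ ≠ (αp : OnePoint ℝ) → ξ ≠ (αm : OnePoint ℝ) →
        ∀ x : ℝ, ξ = x → Q.eval x 1 ≠ 0 := by
      rintro ξ hp hm x rfl hx
      rcases (h.eval_eq_zero_iff x).1 hx with rfl | rfl
      · exact hp rfl
      · exact hm rfl
    refine ⟨αp, αm, h.ne, h.irrational, h.symm.irrational, h.eval_eq_zero_iff,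
      fun ξ hp hm => Q.lyapunov_eq_two_mul tie ha ξ (hoff ξ hp hm), h.lyapunov tie,
      h.symm.lyapunov tie, fun ξ => ⟨fun hξ => ?_, ?_⟩⟩
    · by_contra! hne
      exact Q.not_leadsToRiverEnd tie ha ξ (hoff ξ hne.1 hne.2) hξ
    · rintro (rfl | rfl)
      · exact h.leadsToRiverEnd tie
      · exact h.symm.leadsToRiverEnd tie
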